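/- All graphs are finite, simple and undirected. For a graph $G$ on $n$ vertices, let $z(G;k)$ be the number of zero forcing sets of $G$ of size $k$ (sets $S$ of initially blue vertices from which every vertex becomes blue by repeatedly applying the rule: a blue vertex with exactly one white neighbor turns that neighbor blue). Call $G$ \emph{path-extremal} if $z(G;k)\le z(P_n;k)$ for all $0\le k\le n$, where $P_n$ is the path on $n$ vertices. A \emph{split} of a connected graph $G$ is a partition $(A,B)$ of $V(G)$ with $|A|,|B|\ge 2$ for which there are nonempty $A_1\subseteq A$, $B_1\subseteq B$ such that, for all $a\in A$, $b\in B$, $ab\in E(G)$ if and only if $a\in A_1$ and $b\in B_1$. A connected graph is \emph{split-prime} if it has no split and is neither a clique nor a star. The \emph{canonical split decomposition} of a connected graph $G$ on at least three vertices is its (unique up to isomorphism) reduced graph-labelled tree: a finite tree whose nodes (bags) are labelled by graphs, where the vertices of the label of a bag are the vertices of $G$ assigned to that bag (each vertex of $G$ being assigned to exactly one bag) and one marker vertex for each tree edge at the bag, such that: \begin{itemize} \item each label is a clique or a star on at least three vertices, or is split-prime (the bag is then a \emph{prime bag}, and its size is the number of vertices of its label); \item no tree edge joins two clique bags, and no tree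 edge joins a star bag through a marker that is a leaf of its star to a star bag through a marker that is the center of its star; \item two vertices $u,v$ of $G$ are adjacent if and only if, along the path in the tree from the bag of $u$ to the bag of $v$, $u$ is adjacent in its label to the marker of the first edge, in each intermediate bag the two markers of the path are adjacent, and in the last bag the marker of the last edge is adjacent to $v$ (if $u$ and $v$ lie in the same bag: if and only if they are adjacent in its label). \end{itemize} Let $m\in\mathbb{N}$. Suppose that for every split-prime graph $H$ on at most $m$ vertices, every induced subgraph of $H$ is path-extremal; since this property does not change under isomorphism, it is enough to suppose this for the finitely many split-prime graphs $H$ with vertex set $\{0,\dots,n-1\}$, $n\le m$. Then every connected graph whose canonical split decomposition has exactly one prime bag, and whose prime bag has size at most $m$, is path-extremal. -/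

import Mathlib

universe u v

/-- The zero forcing closure of `S` in `G`: the least set of vertices that contains `S` and is
closed under the color-change rule (a blue vertex all of whose neighbors other than `w` are
blue makes its neighbor `w` blue). -/
inductive ZFClosure {V : Type u} (G : SimpleGraph V) (S : Set V) : V → Prop
  | initial {w : V} (hw : w ∈ S) : ZFClosure G S w
  | force {x w : V} (hx : ZFClosure G S x) (hxw : G.Adj x w)
      (hothers : ∀ y, G.Adj x y → y ≠ w → ZFClosure G S y) : ZFClosure G S w

/-- `S` is a zero forcing set: its closure is the whole vertex set. -/
def IsZeroForcing {V : Type u} (G : SimpleGraph V) (S : Set V) : Prop :=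
  ∀ w, ZFClosure G S w

/-- `z(G;k)`, the number of zero forcing sets of size `k` of a finite graph. -/
noncomputable def zfCount {V : Type u} (G : SimpleGraph V) (k : ℕ) : ℕ :=
  Set.ncard {S : Finset V | S.card = k ∧ IsZeroForcing G (S : Set V)}

/-- A finite graph on `n` vertices is path-extremal if `z(G;k) ≤ z(P_n;k)` for `0 ≤ k ≤ n`. -/
def PathExtremal {V : Type u} (G : SimpleGraph V) : Prop :=
  ∀ k ≤ Nat.card V, zfCount G k ≤ zfCount (SimpleGraph.pathGraph (Nat.card V)) k

/-- `(A, B)` is a split of `G`. -/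
def IsSplit {V : Type u} (G : SimpleGraph V) (A B : Set V) : Prop :=
  A ∪ B = Set.univ ∧ Disjoint A B ∧ 2 ≤ A.encard ∧ 2 ≤ B.encard ∧
    ∃ A₁ ⊆ A, ∃ B₁ ⊆ B, A₁.Nonempty ∧ B₁.Nonempty ∧
      ∀ a ∈ A, ∀ b ∈ B, (G.Adj a b ↔ a ∈ A₁ ∧ b ∈ B₁)

/-- `G` is a star with center `c`. -/
def IsStarWithCenter {V : Type u} (G : SimpleGraph V) (c : V) : Prop :=
  ∀ x y, G.Adj x y ↔ x ≠ y ∧ (x = c ∨ y = c)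

/-- A connected graph without splits that is neither a clique nor a star. -/
def SplitPrime {V : Type u} (G : SimpleGraph V) : Prop :=
  G.Connected ∧ (∀ A B : Set V, ¬ IsSplit G A B) ∧ G ≠ ⊤ ∧ ∀ c, ¬ IsStarWithCenter G c

/-- A graph-labelled tree with bags indexed by `N` and with the ordinary vertices `V`.
Every ordinary vertex lies in exactly one bag, `home`. The vertices of the label graph of the
bag `b` are the ordinary vertices lying in `b` together with one marker vertex for each tree
edge at `b`; the marker of the edge `bc` in `b` is written as the neighbor `c` of `b`. -/
structure GraphLabelledTree (V : Type u) (N : Type v) where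
  tree : SimpleGraph N
  isTree : tree.IsTree
  home : V → N
  label : ∀ b : N, SimpleGraph ({w : V // home w = b} ⊕ {c : N // tree.Adj b c})

namespace GraphLabelledTree

/-- The vertex set of the label graph of the bag `b`. -/
abbrev BagVertex {V : Type u} {N : Type v} (T : GraphLabelledTree V N) (b : N) : Type (max u v) :=
  {w : V // T.home w = b} ⊕ {c : N // T.tree.Adj b c}

/-- An ordinary vertex, as a vertex of the label of its bag. -/
def ordinary {V : Type u} {N : Type v} (T : GraphLabelledTree V N) (w : V) :
    T.BagVertex (T.home w) :=
  Sum.inl ⟨w, rfl⟩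

/-- The marker vertex in the bag `b` corresponding to the tree edge `bc`. -/
def marker {V : Type u} {N : Type v} (T : GraphLabelledTree V N) {b c : N}
    (h : T.tree.Adj b c) : T.BagVertex b :=
  Sum.inr ⟨c, h⟩

/-- Accessibility along a walk `B₀, …, Bₜ` of bags, from a vertex of the label of `B₀` to a
vertex of the label of `Bₜ`: in each bag the vertex at which the walk enters is adjacent to
the marker through which it leaves. -/
def Accessible {V : Type u} {N : Type v} (T : GraphLabelledTree V N) :
    ∀ {b c : N}, T.tree.Walk b c → T.BagVertex b → T.BagVertex c → Prop
  | _, _, .nil, x, y => (T.label _).Adj x y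
  | _, _, .cons h p, x, y => (T.label _).Adj x (T.marker h) ∧ T.Accessible p (T.marker h.symm) y

/-- `T` represents `G`: adjacency in `G` is accessibility along the path between the bags. -/
def Represents {V : Type u} {N : Type v} (T : GraphLabelledTree V N) (G : SimpleGraph V) : Prop :=
  ∀ x y : V, G.Adj x y ↔ ∃ p : T.tree.Walk (T.home x) (T.home y),
    p.IsPath ∧ T.Accessible p (T.ordinary x) (T.ordinary y)

/-- `T` is reduced: every bag is a clique or star bag with at least three vertices, or a prime
bag; no tree edge joins two clique bags; and no tree edge joins a star bag through a
leaf-marker to a star bag through its center-marker. -/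
def IsReduced {V : Type u} {N : Type v} (T : GraphLabelledTree V N) : Prop :=
  (∀ b, (3 ≤ ENat.card (T.BagVertex b) ∧ (T.label b = ⊤ ∨ ∃ c, IsStarWithCenter (T.label b) c))
      ∨ SplitPrime (T.label b)) ∧
  (∀ b c, T.tree.Adj b c → ¬ (T.label b = ⊤ ∧ T.label c = ⊤)) ∧
  (∀ (b c : N) (h : T.tree.Adj b c),
    ¬ ((∃ x, x ≠ T.marker h ∧ IsStarWithCenter (T.label b) x) ∧
        IsStarWithCenter (T.label c) (T.marker h.symm)))

end GraphLabelledTree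

/-- `T` is the canonical split decomposition of `G`, that is, the reduced graph-labelled tree
representing `G` (it is unique up to isomorphism). -/
def IsCanonicalSplitDecomposition {V : Type u} {N : Type v} (G : SimpleGraph V)
    (T : GraphLabelledTree V N) : Prop :=
  T.IsReduced ∧ T.Represents G

/-- The class of connected graphs whose canonical split decomposition has exactly one prime
bag, that bag having at most `m` vertices. -/
def UniquePrimeBagLE {V : Type u} (G : SimpleGraph V) (m : ℕ) : Prop :=
  G.Connected ∧ ∃ (N : Type) (_ : Finite N) (T : GraphLabelledTree V N),
    IsCanonicalSplitDecomposition G T ∧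
    ∃ b : N, SplitPrime (T.label b) ∧ ENat.card (T.BagVertex b) ≤ m ∧
      ∀ c : N, SplitPrime (T.label c) → c = b

/-! A set fails to force exactly when it misses a fort, so path-extremality says that the graph has,
for each `k`, at least as many failing `k`-sets as the path on equally many vertices. This is proved
for every induced subgraph `W`, by induction on its size.

In a path the failing sets are those avoiding both ends and containing no two consecutive vertices.
Hence their number is at most `(n - 2).choose k` and satisfies a Fibonacci-type recurrence. Twins in
`W` form a fort of size two, which already gives that binomial coefficient. A pendant vertex `v` at
`u` gives the reverse recurrence (`failCount_pendant`), and the induction passes to `W - v` and `W -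
v - u`.

It remains to find such vertices. Among the bags with at least two vertices of `W` behind them, seen
from the prime bag, take a farthest one. If it is a clique or a star, two of these vertices are
twins or one has at most one neighbor in `W`. If it is the prime bag itself, either `W` embeds in
its label, where the hypothesis applies, or `W` has an isolated vertex. -/

open Finset

/-! ### Forts and failing sets -/

/-- `F` is a fort of the subgraph of `G` induced by `W`. -/
def IsFortIn {V : Type*} (G : SimpleGraph V) (W F : Set V) : Prop :=
  F ⊆ W ∧ F.Nonempty ∧
    ∀ x ∈ W, x ∉ F → ∀ w ∈ F, G.Adj x w → ∃ y ∈ F, y ≠ w ∧ G.Adj x y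

/-- `S` misses some fort of the subgraph of `G` induced by `W`. -/
def FailsIn {V : Type*} (G : SimpleGraph V) (W S : Set V) : Prop :=
  ∃ F, IsFortIn G W F ∧ Disjoint F S

open Classical in
/-- The number of `k`-subsets of `W` that are not zero forcing in the subgraph induced by `W`. -/
noncomputable def failCount {V : Type*} (G : SimpleGraph V) (W : Finset V) (k : ℕ) : ℕ :=
  #((W.powersetCard k).filter fun S : Finset V => FailsIn G (W : Set V) (S : Set V))

/-- The white vertices left by the closure form a fort; conversely, no vertex of a fort can be the
first of it to be forced. -/
theorem not_isZeroForcing_iff {V : Type*} (G : SimpleGraph V) (S : Set V) :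
    ¬ IsZeroForcing G S ↔ FailsIn G Set.univ S := by
  constructor
  · intro h
    obtain ⟨w, hw⟩ := not_forall.1 h
    refine ⟨{w | ¬ ZFClosure G S w}, ⟨Set.subset_univ _, ⟨w, hw⟩, ?_⟩, ?_⟩
    · intro x _ hx w hw hxw
      by_contra! hcon
      refine hw (ZFClosure.force (not_not.1 hx) hxw fun y hxy hyw => ?_)
      by_contra hy
      exact hcon y hy hyw hxy
    · exact Set.disjoint_left.2 fun x hx hxS => hx (.initial hxS)
  · rintro ⟨F, ⟨-, ⟨w, hw⟩, hF⟩, hdisj⟩ h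
    have key : ∀ x, ZFClosure G S x → x ∉ F := by
      intro x hx
      induction hx with
      | initial hx => exact fun hF => Set.disjoint_left.1 hdisj hF hx
      | force _ hxw _ ihx iho =>
        intro hwF
        obtain ⟨y, hy, hyw, hxy⟩ := hF _ trivial ihx _ hwF hxw
        exact iho y hxy hyw hy
    exact key w (h w) hw

theorem failsIn_image {V V' : Type*} {G : SimpleGraph V} {G' : SimpleGraph V'} (e : G ↪g G')
    (W S : Set V) : FailsIn G' (e '' W) (e '' S) ↔ FailsIn G W S := by
  constructor
  · rintro ⟨F, ⟨hFW, ⟨w, hw⟩, hF⟩, hd⟩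
    refine ⟨e ⁻¹' F, ⟨?_, ?_, ?_⟩, ?_⟩
    · intro x hx
      obtain ⟨y, hy, hyx⟩ := hFW hx
      rwa [← e.injective hyx]
    · obtain ⟨y, hy, rfl⟩ := hFW hw
      exact ⟨y, hw⟩
    · intro x hx hxF w hw hxw
      obtain ⟨y, hy, hyw, hxy⟩ := hF (e x) ⟨x, hx, rfl⟩ hxF (e w) hw (e.map_rel_iff.2 hxw)
      obtain ⟨y, -, rfl⟩ := hFW hy
      exact ⟨y, hy, fun h => hyw (h ▸ rfl), e.map_rel_iff.1 hxy⟩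
    · exact Set.disjoint_left.2 fun x hx hxS => Set.disjoint_left.1 hd hx ⟨x, hxS, rfl⟩
  · rintro ⟨F, ⟨hFW, hne, hF⟩, hd⟩
    refine ⟨e '' F, ⟨Set.image_mono hFW, hne.image _, ?_⟩,
      (Set.disjoint_image_iff e.injective).2 hd⟩
    rintro _ ⟨x, hx, rfl⟩ hxF _ ⟨w, hw, rfl⟩ hxw
    obtain ⟨y, hy, hyw, hxy⟩ := hF x hx (fun h => hxF ⟨x, h, rfl⟩) w hw (e.map_rel_iff.1 hxw)
    exact ⟨e y, ⟨y, hy, rfl⟩, fun h => hyw (e.injective h), e.map_rel_iff.2 hxy⟩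

theorem failCount_map {V V' : Type*} {G : SimpleGraph V} {G' : SimpleGraph V'} (e : G ↪g G')
    (W : Finset V) (k : ℕ) : failCount G' (W.map e.toEmbedding) k = failCount G W k := by
  classical
  unfold failCount
  rw [Finset.powersetCard_map, Finset.filter_map, Finset.card_map]
  congr 1
  refine Finset.filter_congr fun S _ => ?_
  have := failsIn_image e (W : Set V) (S : Set V)
  simpa using this

theorem zfCount_add_failCount {V : Type*} [Fintype V] (G : SimpleGraph V) (k : ℕ) :
    zfCount G k + failCount G univ k = (Nat.card V).choose k := by
  classical
  have h1 : zfCount G k =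
      #(((univ : Finset V).powersetCard k).filter fun S : Finset V =>
        ¬ FailsIn G ((univ : Finset V) : Set V) (S : Set V)) := by
    rw [zfCount, ← Set.ncard_coe_finset]
    congr 1
    ext S
    simp [← not_isZeroForcing_iff, Finset.mem_powersetCard]
  rw [h1, failCount, add_comm, Finset.card_filter_add_card_filter_not, Finset.card_powersetCard,
    Finset.card_univ, Nat.card_eq_fintype_card]

/-! ### Failing sets of paths -/

/-- The number of `k`-sets that are not zero forcing in the path on `n` vertices. -/
noncomputable def pathFail (n k : ℕ) : ℕ := failCount (SimpleGraph.hasse ℕ) (range n) k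

theorem hasse_nat_adj {a b : ℕ} : (SimpleGraph.hasse ℕ).Adj a b ↔ a + 1 = b ∨ b + 1 = a := by
  simp [SimpleGraph.hasse_adj, Nat.covBy_iff_add_one_eq]

theorem failCount_pathGraph (n k : ℕ) :
    failCount (SimpleGraph.pathGraph n) univ k = pathFail n k := by
  let e : SimpleGraph.pathGraph n ↪g SimpleGraph.hasse ℕ :=
    ⟨Fin.valEmbedding, by
      intro a b
      rw [SimpleGraph.pathGraph_adj]
      exact hasse_nat_adj⟩
  rw [← failCount_map e, pathFail]
  congr 1
  ext i
  simp only [mem_map, mem_univ, true_and, mem_range]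
  exact ⟨by rintro ⟨a, rfl⟩; exact a.2, fun h => ⟨⟨i, h⟩, rfl⟩⟩

theorem pathExtremal_iff {V : Type*} [Fintype V] (G : SimpleGraph V) :
    PathExtremal G ↔ ∀ k, pathFail (Nat.card V) k ≤ failCount G univ k := by
  have h1 := zfCount_add_failCount G
  have h2 := zfCount_add_failCount (SimpleGraph.pathGraph (Nat.card V))
  simp only [failCount_pathGraph, Nat.card_fin] at h2
  constructor
  · intro h k
    have := h1 k
    have := h2 k
    by_cases hk : k ≤ Nat.card V
    · have := h k hk
      omega
    · rw [Nat.choose_eq_zero_of_lt (by omega)] at *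
      omega
  · intro h k _
    have := h1 k
    have := h2 k
    have := h k
    omega

/-- For a suitable `S` the whole complement is a fort. Conversely, suppose a fort misses an end or
two consecutive vertices. Then the fort vertex nearest to that gap has, on the side of the gap, a
neighbor outside the fort with no second neighbor in it. -/
theorem failsIn_range_iff {n : ℕ} {S : Finset ℕ} (hS : S ⊆ range n) :
    FailsIn (SimpleGraph.hasse ℕ) (range n : Finset ℕ) (S : Set ℕ) ↔
      0 < n ∧ 0 ∉ S ∧ n - 1 ∉ S ∧ ∀ i ∈ S, i + 1 ∉ S := by
  classical
  constructor
  · rintro ⟨F, ⟨hFW, hne, hF⟩, hd⟩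
    have hlt : ∀ i ∈ F, i < n := fun i hi => by simpa using hFW hi
    have hdisj : ∀ i ∈ S, i ∉ F := fun i hi hiF => Set.disjoint_left.1 hd hiF hi
    -- a gap of two consecutive vertices outside the fort contradicts a next element above
    have up : ∀ i, i ∉ F → (i = 0 ∨ i - 1 ∉ F) → ∀ w ∈ F, i < w → False := by
      intro i hi hi' w hw hiw
      have hex : ∃ w, w ∈ F ∧ i < w := ⟨w, hw, hiw⟩
      obtain ⟨hmF, him⟩ := Nat.find_spec hex
      have hmin : ∀ j < Nat.find hex, i < j → j ∉ F := fun j hj hij hjF =>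
        Nat.find_min hex hj ⟨hjF, hij⟩
      set m := Nat.find hex
      have hm1 : m - 1 ∉ F := by
        by_cases h : m - 1 = i
        · rwa [h]
        · exact hmin _ (by omega) (by omega)
      obtain ⟨y, hy, hym, hadj⟩ := hF (m - 1) (by simpa using (by have := hlt m hmF; omega))
        hm1 m hmF (hasse_nat_adj.2 (by omega))
      rw [hasse_nat_adj] at hadj
      have hy' : y = m - 2 ∧ 2 ≤ m := by omega
      by_cases h : m - 1 = i
      · rcases hi' with h0 | h0
        · omega
        · exact h0 (by rwa [show i - 1 = y by omega])
      by_cases h' : m - 2 = i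
      · exact hi (by rwa [← h', ← hy'.1])
      · exact hmin y (by omega) (by omega) hy
    have down : ∀ i, i < n → i ∉ F → (i + 1 = n ∨ i + 1 ∉ F) → ∀ w ∈ F, w < i → False := by
      intro i hin hi hi' w hw hwi
      -- Mirror image of `up`: minimizing the distance `d` from `i - 1` selects the largest fort
      -- element below `i`.
      have hex : ∃ d, i - 1 - d ∈ F ∧ d < i := ⟨i - 1 - w, by
        rwa [show i - 1 - (i - 1 - w) = w by omega], by omega⟩
      obtain ⟨hmF, him⟩ := Nat.find_spec hex
      have hmin : ∀ j < i, i - 1 - Nat.find hex < j → j ∉ F := fun j hj hij hjF =>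
        Nat.find_min hex (m := i - 1 - j) (by omega)
          ⟨by rwa [show i - 1 - (i - 1 - j) = j by omega], by omega⟩
      set m := i - 1 - Nat.find hex
      have hm1 : m + 1 ∉ F := by
        by_cases h : m + 1 = i
        · rwa [h]
        · exact hmin _ (by omega) (by omega)
      obtain ⟨y, hy, hym, hadj⟩ := hF (m + 1) (by simpa using (by omega))
        hm1 m hmF (hasse_nat_adj.2 (by omega))
      rw [hasse_nat_adj] at hadj
      have hy' : y = m + 2 := by omega
      have := hlt y hy
      by_cases h : m + 1 = i
      · rcases hi' with h0 | h0
        · omega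
        · exact h0 (by rwa [show i + 1 = y by omega])
      by_cases h' : m + 2 = i
      · exact hi (by rwa [← h', ← hy'])
      · exact hmin y (by omega) (by omega) hy
    obtain ⟨w, hw⟩ := hne
    have hwn := hlt w hw
    have key : ∀ i, i ∉ F → w ≠ i := fun i hi h => hi (h ▸ hw)
    refine ⟨by omega, fun h0 => ?_, fun h0 => ?_, fun i hi hi1 => ?_⟩
    · have := key 0 (hdisj 0 h0)
      exact up 0 (hdisj 0 h0) (Or.inl rfl) w hw (by omega)
    · have := key _ (hdisj _ h0)
      exact down (n - 1) (by omega) (hdisj _ h0) (Or.inl (by omega)) w hw (by omega)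
    · have := key _ (hdisj _ hi)
      have := key _ (hdisj _ hi1)
      rcases lt_or_gt_of_ne (key _ (hdisj _ hi)) with h | h
      · exact down i (by simpa using hS hi) (hdisj _ hi) (Or.inr (hdisj _ hi1)) w hw h
      · exact up (i + 1) (hdisj _ hi1) (Or.inr (by simpa using hdisj _ hi)) w hw (by omega)
  · rintro ⟨hn, h0, h1, h2⟩
    refine ⟨{i | i < n ∧ i ∉ S}, ⟨fun i hi => by simpa using hi.1, ⟨0, hn, h0⟩, ?_⟩,
      Set.disjoint_left.2 fun i hi hiS => hi.2 hiS⟩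
    intro x hx hxF w hw hxw
    have hxn : x < n := by simpa using hx
    have hxS : x ∈ S := by by_contra h; exact hxF ⟨hxn, h⟩
    have hx0 : x ≠ 0 := fun h => h0 (h ▸ hxS)
    have hx1 : x ≠ n - 1 := fun h => h1 (h ▸ hxS)
    rw [hasse_nat_adj] at hxw
    rcases hxw with h | h
    · refine ⟨x - 1, ⟨by omega, fun hc => h2 _ hc ?_⟩, by omega, hasse_nat_adj.2 (by omega)⟩
      rwa [show x - 1 + 1 = x by omega]
    · exact ⟨x + 1, ⟨by omega, h2 x hxS⟩, by omega, hasse_nat_adj.2 (by omega)⟩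

theorem pathFail_le_choose (n k : ℕ) : pathFail n k ≤ (n - 2).choose k := by
  classical
  have : #((Ioo 0 (n - 1)).powersetCard k) = (n - 2).choose k := by
    rw [card_powersetCard, Nat.card_Ioo]
    congr 1
  rw [← this, pathFail, failCount]
  refine card_le_card fun S hS => ?_
  rw [mem_filter, mem_powersetCard] at hS
  obtain ⟨⟨hSn, hk⟩, hf⟩ := hS
  obtain ⟨-, h0, h1, -⟩ := (failsIn_range_iff hSn).1 hf
  refine mem_powersetCard.2 ⟨fun i hi => ?_, hk⟩
  have := mem_range.1 (hSn hi)
  have : i ≠ 0 := fun h => h0 (h ▸ hi)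
  have : i ≠ n - 1 := fun h => h1 (h ▸ hi)
  exact mem_Ioo.2 (by omega)

/-- The last vertex `n + 1` is never in a failing set, so the cases are whether `n` is. If it is, `n
- 1` is not, and erasing `n` leaves a failing set of the path on `n` vertices. -/
theorem pathFail_add_two_le (n k : ℕ) :
    pathFail (n + 2) (k + 1) ≤ pathFail (n + 1) (k + 1) + pathFail n k := by
  classical
  unfold pathFail failCount
  refine le_trans (card_le_card (t := _ ∪ Finset.image (insert n) _) ?_)
    ((card_union_le _ _).trans (Nat.add_le_add_left card_image_le _))
  intro S hS
  rw [mem_filter, mem_powersetCard] at hS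
  obtain ⟨⟨hSn, hk⟩, hf⟩ := hS
  obtain ⟨-, h0, h1, h2⟩ := (failsIn_range_iff hSn).1 hf
  simp only [show n + 2 - 1 = n + 1 by omega] at h1
  have hlt : ∀ i ∈ S, i < n + 1 := fun i hi => by
    have := mem_range.1 (hSn hi)
    have : i ≠ n + 1 := fun h => h1 (h ▸ hi)
    omega
  by_cases hn : n ∈ S
  · refine mem_union_right _ (mem_image.2 ⟨S.erase n, ?_, insert_erase hn⟩)
    have hn0 : n ≠ 0 := fun h => h0 (h ▸ hn)
    have hsub : S.erase n ⊆ range n := fun i hi => by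
      have := hlt i (mem_of_mem_erase hi)
      have := ne_of_mem_erase hi
      exact mem_range.2 (by omega)
    rw [mem_filter, mem_powersetCard, failsIn_range_iff hsub, card_erase_of_mem hn]
    refine ⟨⟨hsub, by omega⟩, by omega, fun h => h0 (mem_of_mem_erase h), fun h => ?_,
      fun i hi h => h2 i (mem_of_mem_erase hi) (mem_of_mem_erase h)⟩
    refine h2 _ (mem_of_mem_erase h) ?_
    rwa [show n - 1 + 1 = n by omega]
  · refine mem_union_left _ ?_
    have hsub : S ⊆ range (n + 1) := fun i hi => mem_range.2 (hlt i hi)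
    rw [mem_filter, mem_powersetCard, failsIn_range_iff hsub]
    exact ⟨⟨hsub, hk⟩, by omega, h0, by simpa using hn, h2⟩

/-! ### Lower bounds from forts and pendant vertices -/

theorem choose_le_failCount {V : Type*} [DecidableEq V] (G : SimpleGraph V) (W F : Finset V)
    (hF : IsFortIn G (W : Set V) (F : Set V)) (k : ℕ) :
    (#W - #F).choose k ≤ failCount G W k := by
  classical
  have hFW : F ⊆ W := by exact_mod_cast hF.1
  rw [← card_sdiff_of_subset hFW, ← card_powersetCard, failCount]
  refine card_le_card fun S hS => ?_
  rw [mem_powersetCard] at hS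
  refine mem_filter.2 ⟨mem_powersetCard.2 ⟨hS.1.trans sdiff_subset, hS.2⟩, F, hF, ?_⟩
  exact Set.disjoint_left.2 fun x hx hxS => (mem_sdiff.1 (hS.1 hxS)).2 hx

/-- Failing sets of `W - v` are turned into failing sets of `W` without `u`, and failing sets of `W
- v - u` into failing sets with `u`. Both maps are injective, and the forts survive after adding `v`
where needed. -/
theorem failCount_pendant {V : Type*} [DecidableEq V] (G : SimpleGraph V) (W : Finset V) {u v : V}
    (hu : u ∈ W) (hv : v ∈ W) (huv : G.Adj v u) (h : ∀ z ∈ W, G.Adj v z → z = u) (k : ℕ) :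
    failCount G (W.erase v) (k + 1) + failCount G ((W.erase v).erase u) k ≤
      failCount G W (k + 1) := by
  classical
  have hne : v ≠ u := huv.ne
  have huv' : ∀ z ∈ W, G.Adj z v → z = u := fun z hz hzv => h z hz hzv.symm
  -- Trading `u` for `v` keeps the size and makes every image avoid `u`.
  let f : Finset V → Finset V := fun S => if u ∈ S then insert v (S.erase u) else S
  set A := ((W.erase v).powersetCard (k + 1)).filter fun S : Finset V =>
    FailsIn G (W.erase v : Finset V) (S : Set V)
    with hA
  set B := (((W.erase v).erase u).powersetCard k).filter fun S : Finset V =>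
    FailsIn G ((W.erase v).erase u : Finset V) (S : Set V) with hB
  have hAv : ∀ S ∈ A, S ⊆ W ∧ v ∉ S ∧ #S = k + 1 ∧
      FailsIn G (W.erase v : Finset V) (S : Set V) := by
    intro S hS
    rw [hA, mem_filter, mem_powersetCard] at hS
    exact ⟨hS.1.1.trans (erase_subset _ _), fun hc => by simpa using hS.1.1 hc, hS.1.2, hS.2⟩
  have hBv : ∀ S ∈ B, S ⊆ W ∧ v ∉ S ∧ u ∉ S ∧ #S = k ∧
      FailsIn G ((W.erase v).erase u : Finset V) (S : Set V) := by
    intro S hS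
    rw [hB, mem_filter, mem_powersetCard] at hS
    refine ⟨hS.1.1.trans ((erase_subset _ _).trans (erase_subset _ _)),
      fun hc => by simpa using hS.1.1 hc, fun hc => by simpa using hS.1.1 hc, hS.1.2, hS.2⟩
  have hfu : ∀ S, u ∉ f S := by
    intro S
    by_cases hS : u ∈ S <;> simp [f, hS, hne.symm]
  have hfinj : Set.InjOn f A := by
    intro S hS S' hS' hSS
    have h1 := (hAv S hS).2.1
    have h2 := (hAv S' hS').2.1
    by_cases hS1 : u ∈ S <;> by_cases hS2 : u ∈ S' <;> simp only [f, hS1, hS2, if_true, if_false] at hSS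
    · have h3 := congrArg (fun X => insert u (X.erase v)) hSS
      simpa [erase_insert, h1, h2, insert_erase, hS1, hS2] using h3
    · exact absurd (hSS ▸ mem_insert_self v _) h2
    · exact absurd (hSS ▸ mem_insert_self v _) h1
    · exact hSS
  have hginj : Set.InjOn (insert u) (B : Set (Finset V)) := by
    intro S hS S' hS' hSS
    have h3 := congrArg (fun X => X.erase u) hSS
    simpa [(hBv S hS).2.2.1, (hBv S' hS').2.2.1] using h3
  have hdisj : Disjoint (A.image f) (B.image (insert u)) := by
    rw [disjoint_left]
    intro X hX hX'
    obtain ⟨S, -, rfl⟩ := mem_image.1 hX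
    obtain ⟨S', -, hS'⟩ := mem_image.1 hX'
    exact hfu S (hS' ▸ mem_insert_self u S')
  have hunfold : failCount G (W.erase v) (k + 1) + failCount G ((W.erase v).erase u) k
      = #A + #B := rfl
  rw [hunfold, ← card_image_of_injOn hfinj, ← card_image_of_injOn hginj,
    ← card_union_of_disjoint hdisj, failCount]
  refine card_le_card (union_subset ?_ ?_)
  · intro X hX
    obtain ⟨S, hS, rfl⟩ := mem_image.1 hX
    obtain ⟨hSW, hvS, hcard, F, ⟨hFW, hFne, hF⟩, hd⟩ := hAv S hS
    have hFW' : ∀ x ∈ F, x ∈ W ∧ x ≠ v := fun x hx => by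
      have := hFW hx
      simp only [coe_erase, Set.mem_sdiff, mem_coe, Set.mem_singleton_iff] at this
      exact this
    have hF' : ∀ x ∈ W, x ≠ v → x ∉ F → ∀ w ∈ F, G.Adj x w → ∃ y ∈ F, y ≠ w ∧ G.Adj x y :=
      fun x hx hxv => hF x (by simp [hx, hxv])
    have hdS : ∀ x ∈ F, x ∉ S := fun x hx hxS => Set.disjoint_left.1 hd hx hxS
    by_cases huS : u ∈ S
    · have hfS : f S = insert v (S.erase u) := by simp [f, huS]
      have hve : v ∉ S.erase u := fun hc => hvS (mem_of_mem_erase hc)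
      rw [mem_filter, mem_powersetCard, hfS, card_insert_of_notMem hve, card_erase_of_mem huS]
      refine ⟨⟨insert_subset hv ((erase_subset _ _).trans hSW), by omega⟩, F,
        ⟨fun x hx => (hFW' x hx).1, hFne, ?_⟩, ?_⟩
      · intro x hx hxF w hw hxw
        by_cases hxv : x = v
        · subst hxv
          have := h w (hFW' w hw).1 hxw
          exact absurd huS (this ▸ hdS w hw)
        · exact hF' x hx hxv hxF w hw hxw
      · refine Set.disjoint_left.2 fun x hx hxS => ?_
        rw [mem_coe, mem_insert] at hxS
        rcases hxS with rfl | hxS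
        · exact (hFW' _ hx).2 rfl
        · exact hdS x hx (mem_of_mem_erase hxS)
    · have hfS : f S = S := by simp [f, huS]
      rw [mem_filter, mem_powersetCard, hfS]
      refine ⟨⟨hSW, hcard⟩, ?_⟩
      -- If `u` is in the fort, `v` would see only `u` in it, so `v` must join; this creates no new
      -- condition, as `u` is its only neighbor.
      by_cases huF : u ∈ F
      · refine ⟨insert v F, ⟨?_, ⟨v, Or.inl rfl⟩, ?_⟩, ?_⟩
        · rintro x (rfl | hx)
          · exact hv
          · exact (hFW' x hx).1
        · intro x hx hxF w hw hxw
          have hxv : x ≠ v := fun hc => hxF (Or.inl hc)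
          have hxF' : x ∉ F := fun hc => hxF (Or.inr hc)
          rcases hw with rfl | hw
          · exact absurd huF (huv' x hx hxw ▸ hxF')
          · obtain ⟨y, hy, hyw, hxy⟩ := hF' x hx hxv hxF' w hw hxw
            exact ⟨y, Or.inr hy, hyw, hxy⟩
        · refine Set.disjoint_left.2 fun x hx hxS => ?_
          rcases hx with rfl | hx
          · exact hvS hxS
          · exact hdS x hx hxS
      · refine ⟨F, ⟨fun x hx => (hFW' x hx).1, hFne, ?_⟩, hd⟩
        intro x hx hxF w hw hxw
        by_cases hxv : x = v
        · subst hxv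
          exact absurd hw ((h w (hFW' w hw).1 hxw) ▸ huF)
        · exact hF' x hx hxv hxF w hw hxw
  · intro X hX
    obtain ⟨S, hS, rfl⟩ := mem_image.1 hX
    obtain ⟨hSW, hvS, huS, hcard, F, ⟨hFW, hFne, hF⟩, hd⟩ := hBv S hS
    have hFW' : ∀ x ∈ F, x ∈ W ∧ x ≠ v ∧ x ≠ u := fun x hx => by
      have := hFW hx
      simp only [coe_erase, Set.mem_sdiff, mem_coe, Set.mem_singleton_iff] at this
      tauto
    have hF' : ∀ x ∈ W, x ≠ v → x ≠ u → x ∉ F → ∀ w ∈ F, G.Adj x w →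
        ∃ y ∈ F, y ≠ w ∧ G.Adj x y :=
      fun x hx hxv hxu => hF x (by simp [hx, hxv, hxu])
    have hdS : ∀ x ∈ F, x ∉ S := fun x hx hxS => Set.disjoint_left.1 hd hx hxS
    rw [mem_filter, mem_powersetCard, card_insert_of_notMem huS, hcard]
    refine ⟨⟨insert_subset hu hSW, rfl⟩, ?_⟩
    -- When `u` already sees the fort, adding `v` gives `u` a second neighbor there, so the blue
    -- vertex `u` cannot force.
    by_cases hex : ∃ z ∈ F, G.Adj u z
    · obtain ⟨z, hzF, huz⟩ := hex
      refine ⟨insert v F, ⟨?_, ⟨v, Or.inl rfl⟩, ?_⟩, ?_⟩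
      · rintro x (rfl | hx)
        · exact hv
        · exact (hFW' x hx).1
      · intro x hx hxF w hw hxw
        have hxv : x ≠ v := fun hc => hxF (Or.inl hc)
        have hxF' : x ∉ F := fun hc => hxF (Or.inr hc)
        rcases hw with rfl | hw
        · obtain rfl := huv' x hx hxw
          exact ⟨z, Or.inr hzF, (hFW' z hzF).2.1, huz⟩
        · by_cases hxu : x = u
          · subst hxu
            exact ⟨v, Or.inl rfl, (hFW' w hw).2.1.symm, huv.symm⟩
          · obtain ⟨y, hy, hyw, hxy⟩ := hF' x hx hxv hxu hxF' w hw hxw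
            exact ⟨y, Or.inr hy, hyw, hxy⟩
      · refine Set.disjoint_left.2 fun x hx hxS => ?_
        rw [mem_coe, mem_insert] at hxS
        rcases hx with rfl | hx
        · exact hxS.elim hne hvS
        · exact hxS.elim (hFW' x hx).2.2 (hdS x hx)
    · push Not at hex
      refine ⟨F, ⟨fun x hx => (hFW' x hx).1, hFne, ?_⟩, ?_⟩
      · intro x hx hxF w hw hxw
        by_cases hxv : x = v
        · subst hxv
          exact absurd (h w (hFW' w hw).1 hxw) (hFW' w hw).2.2
        by_cases hxu : x = u
        · subst hxu
          exact absurd hxw (hex w hw)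
        · exact hF' x hx hxv hxu hxF w hw hxw
      · refine Set.disjoint_left.2 fun x hx hxS => ?_
        rw [mem_coe, mem_insert] at hxS
        exact hxS.elim (hFW' x hx).2.2 (hdS x hx)

/-! ### Induction over induced subgraphs -/

/-- `x` and `y` are distinct twins in the subgraph of `G` induced by `W`. -/
def TwinsIn {V : Type*} (G : SimpleGraph V) (W : Finset V) (x y : V) : Prop :=
  x ∈ W ∧ y ∈ W ∧ x ≠ y ∧ ∀ z ∈ W, z ≠ x → z ≠ y → (G.Adj x z ↔ G.Adj y z)

/-- All neighbors of `v` in the subgraph of `G` induced by `W` are equal to `u`. -/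
def PendantIn {V : Type*} (G : SimpleGraph V) (W : Finset V) (v u : V) : Prop :=
  v ∈ W ∧ ∀ z ∈ W, G.Adj v z → z = u

theorem pathFail_le_failCount {V : Type*} (G : SimpleGraph V)
    (h : ∀ W : Finset V, (∀ k, pathFail #W k ≤ failCount G W k) ∨
      (∃ x y, TwinsIn G W x y) ∨ ∃ v u, PendantIn G W v u) (W : Finset V) (k : ℕ) :
    pathFail #W k ≤ failCount G W k := by
  classical
  induction hn : #W using Nat.strong_induction_on generalizing W k with
  | _ n ih =>
  subst hn
  rcases h W with hW | ⟨x, y, hx, hy, hxy, htw⟩ | ⟨v, u, hv, hvu⟩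
  · exact hW k
  · refine (pathFail_le_choose _ _).trans ?_
    rw [← card_pair hxy]
    refine choose_le_failCount G W _ ⟨?_, ⟨x, by simp⟩, ?_⟩ k
    · rw [coe_subset, insert_subset_iff, singleton_subset_iff]
      exact ⟨hx, hy⟩
    · intro z hz hzF w hw hzw
      simp only [coe_insert, coe_singleton, Set.mem_insert_iff, Set.mem_singleton_iff,
        not_or] at hzF hw ⊢
      rcases hw with rfl | rfl
      · exact ⟨y, Or.inr rfl, hxy.symm, ((htw z hz hzF.1 hzF.2).1 hzw.symm).symm⟩
      · exact ⟨x, Or.inl rfl, hxy, ((htw z hz hzF.1 hzF.2).2 hzw.symm).symm⟩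
  · by_cases hadj : u ∈ W ∧ G.Adj v u
    · obtain ⟨hu, hadj⟩ := hadj
      have hu' : u ∈ W.erase v := mem_erase.2 ⟨hadj.ne', hu⟩
      have hc1 := card_erase_add_one hv
      have hc2 := card_erase_add_one hu'
      cases k with
      -- The recurrence needs a positive size; for size zero the empty set misses the fort `W`.
      | zero =>
        refine (pathFail_le_choose _ _).trans ?_
        rw [Nat.choose_zero_right]
        have := choose_le_failCount G W W ⟨subset_rfl, ⟨u, hu⟩, fun x hx hx' => absurd hx hx'⟩ 0
        simpa using this
      | succ k =>
        have h1 := ih _ (by omega) (W.erase v) (k + 1) rfl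
        have h2 := ih _ (by omega) ((W.erase v).erase u) k rfl
        have h3 := failCount_pendant G W hu hv hadj hvu k
        have h4 := pathFail_add_two_le #((W.erase v).erase u) k
        rw [hc2] at h4
        rw [show #((W.erase v).erase u) + 2 = #W by omega] at h4
        omega
    -- Here `v` is isolated in `W`, so `{v}` alone is a fort.
    · refine (pathFail_le_choose _ _).trans ((Nat.choose_le_choose k ?_).trans
        (choose_le_failCount G W {v} ⟨by simpa using hv, ⟨v, by simp⟩, ?_⟩ k))
      · rw [card_singleton]
        omega
      · intro z hz _ w hw hzw
        simp only [coe_singleton, Set.mem_singleton_iff] at hw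
        subst hw
        have := hvu z hz hzw.symm
        exact absurd ⟨this ▸ hz, this ▸ hzw.symm⟩ hadj

/-! ### Adjacency seen from a bag of a graph-labelled tree -/

namespace GraphLabelledTree

/-- The vertex of the label of `b` that represents the ordinary vertex `x` lying in the bag at
the end of a walk from `b`: `x` itself, or the marker of the first edge of the walk. -/
def proj {V : Type u} {N : Type v} (T : GraphLabelledTree V N) :
    ∀ {b a : N}, T.tree.Walk b a → ∀ x : V, T.home x = a → T.BagVertex b
  | _, _, .nil, x, hx => Sum.inl ⟨x, hx⟩
  | _, _, .cons h _, _, _ => T.marker h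

/-- The ordinary vertex `x` is accessible from its representative at the start of the walk. -/
def Reaches {V : Type u} {N : Type v} (T : GraphLabelledTree V N) :
    ∀ {b a : N}, T.tree.Walk b a → ∀ x : V, T.home x = a → Prop
  | _, _, .nil, _, _ => True
  | _, _, .cons (v := c) h p, x, hx =>
    (T.label c).Adj (T.marker h.symm) (T.proj p x hx) ∧ T.Reaches p x hx

variable {V : Type u} {N : Type v} (T : GraphLabelledTree V N)

theorem proj_cons {b c a : N} (h : T.tree.Adj b c) (p : T.tree.Walk c a) (x : V)
    (hx : T.home x = a) : T.proj (.cons h p) x hx = T.marker h := rfl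

theorem accessible_iff {b a : N} (q : T.tree.Walk b a) (X : T.BagVertex b) (y : V)
    (hy : T.home y = a) :
    T.Accessible q X (Sum.inl ⟨y, hy⟩) ↔ (T.label b).Adj X (T.proj q y hy) ∧ T.Reaches q y hy := by
  induction q with
  | nil => simp [Accessible, proj, Reaches]
  | cons h p ih => simp only [Accessible, proj_cons, Reaches, ih _ hy]

/-- Accessibility is symmetric edge by edge, so the base bag can be moved along the walk: each
induction step shifts one edge from `p` to `q`. -/
theorem accessible_reverse_append_iff {b a a' : N} (p : T.tree.Walk b a) (q : T.tree.Walk b a')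
    (x y : V) (hx : T.home x = a) (hy : T.home y = a') :
    T.Accessible (p.reverse.append q) (Sum.inl ⟨x, hx⟩) (Sum.inl ⟨y, hy⟩) ↔
      T.Reaches p x hx ∧ (T.label b).Adj (T.proj p x hx) (T.proj q y hy) ∧ T.Reaches q y hy := by
  induction p with
  | nil => simp [accessible_iff, proj, Reaches]
  | cons h p ih =>
    rw [SimpleGraph.Walk.reverse_cons, ← SimpleGraph.Walk.append_assoc,
      SimpleGraph.Walk.cons_append, SimpleGraph.Walk.nil_append, ih (.cons h.symm q) hx]
    simp only [proj_cons, Reaches, SimpleGraph.adj_comm _ (T.marker h.symm)]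
    tauto

theorem proj_eq_iff_head? {b a a' : N} (p : T.tree.Walk b a) (q : T.tree.Walk b a')
    {x y : V} (hx : T.home x = a) (hy : T.home y = a') :
    T.proj p x hx = T.proj q y hy ↔ p.edges.head? = q.edges.head? ∧ (p.Nil → x = y) := by
  cases p with
  | nil => cases q <;> simp [proj, marker]
  | cons h p =>
    cases q with
    | nil => simp [proj, marker]
    | cons h' q =>
      simp only [proj, marker, Sum.inr.injEq, Subtype.mk.injEq, SimpleGraph.Walk.edges_cons,
        List.head?_cons, Option.some.injEq, Sym2.congr_right, SimpleGraph.Walk.not_nil_cons,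
        false_imp_iff, and_true]

theorem exists_cons_of_proj_eq {b a a' : N} {p : T.tree.Walk b a} {q : T.tree.Walk b a'}
    {x y : V} {hx : T.home x = a} {hy : T.home y = a'} (hne : x ≠ y)
    (heq : T.proj p x hx = T.proj q y hy) :
    ∃ (d : N) (h : T.tree.Adj b d) (p' : T.tree.Walk d a) (q' : T.tree.Walk d a'),
      p = .cons h p' ∧ q = .cons h q' := by
  cases p with
  | nil => cases q <;> simp_all [proj, marker]
  | cons h p =>
    cases q with
    | nil => simp [proj, marker] at heq
    | cons h' q =>
      simp only [proj, marker, Sum.inr.injEq, Subtype.mk.injEq] at heq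
      subst heq
      exact ⟨_, h, p, q, rfl, rfl⟩

/-- In a forest a walk is a path once no two consecutive edges coincide; distinct representatives
rule out backtracking at `b`. -/
theorem isPath_reverse_append {b a a' : N} {p : T.tree.Walk b a} {q : T.tree.Walk b a'}
    (hp : p.IsPath) (hq : q.IsPath) {x y : V} {hx : T.home x = a} {hy : T.home y = a'}
    (hne : T.proj p x hx ≠ T.proj q y hy) : (p.reverse.append q).IsPath := by
  cases p with
  | nil => simpa using hq
  | cons h p =>
    have hac := T.isTree.isAcyclic
    rw [hac.isPath_iff_isChain, SimpleGraph.Walk.edges_append, List.isChain_append]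
    refine ⟨(hac.isPath_iff_isChain _).1 hp.reverse, (hac.isPath_iff_isChain _).1 hq, ?_⟩
    rintro e he e' he' rfl
    rw [SimpleGraph.Walk.edges_reverse, List.getLast?_reverse] at he
    refine hne ((T.proj_eq_iff_head? _ _ _ _).2 ⟨?_, fun h => by simp at h⟩)
    rw [Option.mem_def.1 he, Option.mem_def.1 he']

theorem isPath_append_congr {r b a a' : N} {w : T.tree.Walk r b} {p : T.tree.Walk b a}
    {q : T.tree.Walk b a'} (hq : q.IsPath) {x y : V} {hx : T.home x = a} {hy : T.home y = a'}
    (heq : T.proj p x hx = T.proj q y hy) (hp : (w.append p).IsPath) :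
    (w.append q).IsPath := by
  have hac := T.isTree.isAcyclic
  rw [hac.isPath_iff_isChain, SimpleGraph.Walk.edges_append, List.isChain_append] at hp ⊢
  rw [((T.proj_eq_iff_head? _ _ _ _).1 heq).1] at hp
  exact ⟨hp.1, (hac.isPath_iff_isChain _).1 hq, hp.2.2⟩

/-- The unique tree path between the two home bags passes through `b`, so adjacency depends only on
the representatives in `b` and on whether each vertex is accessible from its own. -/
theorem adj_iff_of_proj_ne {G : SimpleGraph V} (hG : T.Represents G) {b : N} {x y : V}
    {p : T.tree.Walk b (T.home x)} {q : T.tree.Walk b (T.home y)} (hp : p.IsPath) (hq : q.IsPath)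
    (hne : T.proj p x rfl ≠ T.proj q y rfl) :
    G.Adj x y ↔
      T.Reaches p x rfl ∧ (T.label b).Adj (T.proj p x rfl) (T.proj q y rfl) ∧ T.Reaches q y rfl := by
  rw [hG x y, ← accessible_reverse_append_iff]
  have hpq := T.isPath_reverse_append hp hq hne
  constructor
  · rintro ⟨r, hr, hacc⟩
    rwa [(T.isTree.existsUnique_path _ _).unique hpq hr]
  · exact fun h => ⟨_, hpq, h⟩

/-- If all bags but `r` are cliques or stars, every induced subgraph of the represented graph
embeds in the label of `r` or has twins or a vertex with at most one neighbor. -/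
theorem exists_embedding_or_twins_or_pendant [Finite N] {G : SimpleGraph V}
    (hG : T.Represents G) (r : N)
    (hdeg : ∀ c, c ≠ r → T.label c = ⊤ ∨ ∃ z, IsStarWithCenter (T.label c) z) (W : Finset V) :
    (∃ f : V → T.BagVertex r, Set.InjOn f W ∧
        ∀ x ∈ W, ∀ y ∈ W, G.Adj x y ↔ (T.label r).Adj (f x) (f y)) ∨
      (∃ x y, TwinsIn G W x y) ∨ ∃ v u, PendantIn G W v u := by
  classical
  have := Fintype.ofFinite N
  choose P hP using fun (b : N) (x : V) => (T.isTree.existsUnique_path b (T.home x)).exists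
  have hadj := fun (b : N) (x y : V) => T.adj_iff_of_proj_ne hG (hP b x) (hP b y)
  set pr : ∀ b, V → T.BagVertex b := fun b x => T.proj (P b x) x rfl
  set ac : N → V → Prop := fun b x => T.Reaches (P b x) x rfl
  by_cases hcard : (W : Set V).Subsingleton
  · rcases W.eq_empty_or_nonempty with rfl | ⟨x, hx⟩
    · exact Or.inl ⟨pr r, by simp, by simp⟩
    · exact Or.inr (Or.inr ⟨x, x, hx, fun z hz _ => hcard hz hx⟩)
  -- a longest path from `r` behind which there are two elements of `W`
  let Q : ℕ → Prop := fun n => ∃ (c : N) (w : T.tree.Walk r c), w.length = n ∧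
    ∃ x ∈ W, ∃ y ∈ W, x ≠ y ∧ (w.append (P c x)).IsPath ∧ (w.append (P c y)).IsPath
  have hbound : ∀ n, Q n → n ≤ Fintype.card N := by
    rintro n ⟨c, w, rfl, x, -, y, -, -, h, -⟩
    exact h.of_append_left.length_lt.le
  have hQ0 : Q 0 := by
    obtain ⟨x, hx, y, hy, hxy⟩ := Set.not_subsingleton_iff.1 hcard
    exact ⟨r, .nil, rfl, x, hx, y, hy, hxy, by simpa using hP r x, by simpa using hP r y⟩
  obtain ⟨c, w, hwl, x, hx, y, hy, hxy, hwx, hwy⟩ :=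
    Nat.findGreatest_spec (P := Q) (Nat.zero_le (Fintype.card N)) hQ0
  have hmax : ∀ n, Q n → n ≤ w.length := fun n hn =>
    hwl ▸ Nat.le_findGreatest (hbound n hn) hn
  -- the representatives in the label of `c` are distinct
  have hinj : ∀ x ∈ W, (w.append (P c x)).IsPath → ∀ z ∈ W, z ≠ x → pr c x ≠ pr c z := by
    intro x hx hwx z hz hzx heq
    -- A shared representative is the marker of an edge leading farther from `r`, with both vertices
    -- behind it, against maximality. This covers every `z` in `W`, also those not behind `c`.
    have hwz : (w.append (P c z)).IsPath := T.isPath_append_congr (hP c z) heq hwx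
    obtain ⟨d, h, p, q, hp, hq⟩ := T.exists_cons_of_proj_eq hzx.symm heq
    have hxp := hp ▸ hP c x
    have hzq := hq ▸ hP c z
    rw [hp, ← SimpleGraph.Walk.concat_append,
      (T.isTree.existsUnique_path _ _).unique hxp.of_cons (hP d x)] at hwx
    rw [hq, ← SimpleGraph.Walk.concat_append,
      (T.isTree.existsUnique_path _ _).unique hzq.of_cons (hP d z)] at hwz
    have := hmax _ ⟨d, w.concat h, rfl, x, hx, z, hz, hzx.symm, hwx, hwz⟩
    rw [SimpleGraph.Walk.length_concat] at this
    omega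
  -- A vertex not accessible from its representative is isolated in `W`, recorded as pendant to
  -- itself.
  have hiso : ∀ x ∈ W, (w.append (P c x)).IsPath → ¬ ac c x → PendantIn G W x x := by
    intro x hx hwx hac
    refine ⟨hx, fun z hz hxz => ?_⟩
    by_contra hzx
    exact hac ((hadj c x z (hinj x hx hwx z hz hzx)).1 hxz).1
  by_cases hcr : c = r
  · subst hcr
    have hall : ∀ x, (w.append (P c x)).IsPath := by
      -- The path `w` is closed, hence trivial, so every vertex lies behind `c`.
      intro z
      rw [(T.isTree.existsUnique_path _ _).unique hwx.of_append_left SimpleGraph.Walk.IsPath.nil]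
      simpa using hP c z
    by_cases hac : ∀ x ∈ W, ac c x
    · refine Or.inl ⟨pr c, fun x hx y hy hxy => ?_, fun x hx y hy => ?_⟩
      · by_contra hne
        exact hinj x hx (hall x) y hy (Ne.symm hne) hxy
      · by_cases hxy : x = y
        · subst hxy
          simp
        · rw [hadj c x y (hinj x hx (hall x) y hy (Ne.symm hxy))]
          exact ⟨fun h => h.2.1, fun h => ⟨hac x hx, h, hac y hy⟩⟩
    · push Not at hac
      obtain ⟨x, hx, hxa⟩ := hac
      exact Or.inr (Or.inr ⟨x, x, hiso x hx (hall x) hxa⟩)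
  refine Or.inr ?_
  by_cases hax : ac c x
  swap
  · exact Or.inr ⟨x, x, hiso x hx hwx hax⟩
  by_cases hay : ac c y
  swap
  · exact Or.inr ⟨y, y, hiso y hy hwy hay⟩
  have hxz := fun z hz hne => hinj x hx hwx z hz hne
  have hyz := fun z hz hne => hinj y hy hwy z hz hne
  -- a leaf of a star whose center represents a vertex of `W`
  have hpend : ∀ x ∈ W, ∀ y ∈ W, y ≠ x → (w.append (P c x)).IsPath → (w.append (P c y)).IsPath →
      IsStarWithCenter (T.label c) (pr c x) → PendantIn G W y x := by
    intro x hx y hy hyx hwx hwy hstar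
    refine ⟨hy, fun z hz hyz => ?_⟩
    by_contra hzx
    have h1 := ((hadj c y z (hinj y hy hwy z hz hyz.ne')).1 hyz).2.1
    rcases ((hstar _ _).1 h1).2 with h | h
    · exact hinj x hx hwx y hy hyx h.symm
    · exact hinj x hx hwx z hz hzx h.symm
  rcases hdeg c hcr with htop | ⟨s, hs⟩
  · refine Or.inl ⟨x, y, hx, hy, hxy, fun z hz hzx hzy => ?_⟩
    rw [hadj c x z (hxz z hz hzx), hadj c y z (hyz z hz hzy), htop, SimpleGraph.top_adj,
      SimpleGraph.top_adj]
    have h1 : pr c x ≠ pr c z := hxz z hz hzx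
    have h2 : pr c y ≠ pr c z := hyz z hz hzy
    tauto
  · by_cases hsx : s = pr c x
    · exact Or.inr ⟨y, x, hpend x hx y hy hxy.symm hwx hwy (hsx ▸ hs)⟩
    by_cases hsy : s = pr c y
    · exact Or.inr ⟨x, y, hpend y hy x hx hxy hwy hwx (hsy ▸ hs)⟩
    -- Both representatives are leaves of the star, so each is adjacent to the center only.
    refine Or.inl ⟨x, y, hx, hy, hxy, fun z hz hzx hzy => ?_⟩
    rw [hadj c x z (hxz z hz hzx), hadj c y z (hyz z hz hzy), hs, hs]
    have h1 : pr c x ≠ pr c z := hxz z hz hzx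
    have h2 : pr c y ≠ pr c z := hyz z hz hzy
    have h3 : pr c x ≠ s := fun h => hsx h.symm
    have h4 : pr c y ≠ s := fun h => hsy h.symm
    tauto

end GraphLabelledTree

/-! ### Transfer to the prime label and conclusion -/

theorem failCount_induce {V : Type*} (G : SimpleGraph V) (S : Set V) [Fintype S] (k : ℕ) :
    failCount (G.induce S) univ k = failCount G S.toFinset k := by
  rw [← failCount_map (SimpleGraph.Embedding.induce S)]
  congr 1

theorem SplitPrime.of_iso {V V' : Type*} {G : SimpleGraph V} {G' : SimpleGraph V'} (e : G ≃g G')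
    (h : SplitPrime G) : SplitPrime G' := by
  obtain ⟨hc, hs, ht, hst⟩ := h
  refine ⟨(SimpleGraph.Iso.connected_iff e).1 hc, ?_, ?_, ?_⟩
  · rintro A B ⟨hAB, hd, hA, hB, A₁, hA₁, B₁, hB₁, hA₁n, hB₁n, hadj⟩
    refine hs (e ⁻¹' A) (e ⁻¹' B) ⟨?_, hd.preimage e, ?_, ?_, e ⁻¹' A₁, Set.preimage_mono hA₁,
      e ⁻¹' B₁, Set.preimage_mono hB₁, ?_, ?_, fun a ha b hb => ?_⟩
    · rw [← Set.preimage_union, hAB, Set.preimage_univ]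
    · rwa [Set.encard_preimage_of_bijective e.bijective]
    · rwa [Set.encard_preimage_of_bijective e.bijective]
    · exact hA₁n.preimage e.surjective
    · exact hB₁n.preimage e.surjective
    · rw [← e.map_rel_iff]
      exact hadj _ ha _ hb
  · rintro rfl
    refine ht (SimpleGraph.ext (funext₂ fun x y => propext ?_))
    rw [← e.map_rel_iff]
    simp
  · intro c hcen
    refine hst (e.symm c) fun x y => ?_
    rw [← e.map_rel_iff, hcen]
    simp [RelIso.eq_symm_apply]

/-- An induced subgraph of `G` that embeds in `H` fails as often as a path does, provided that
the induced subgraphs of `H` are path-extremal. -/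
theorem pathFail_le_failCount_of_embedding {V X : Type*} [Finite X] {G : SimpleGraph V}
    {H : SimpleGraph X} (hH : ∀ S : Set X, PathExtremal (H.induce S)) (W : Finset V) (f : V → X)
    (hf : Set.InjOn f W) (hadj : ∀ x ∈ W, ∀ y ∈ W, G.Adj x y ↔ H.Adj (f x) (f y)) (k : ℕ) :
    pathFail #W k ≤ failCount G W k := by
  classical
  have := Fintype.ofFinite X
  let e : G.induce (W : Set V) ↪g H :=
    ⟨⟨fun x => f x, fun x y hxy => Subtype.ext (hf x.2 y.2 hxy)⟩,
      fun {x y} => (hadj x x.2 y y.2).symm⟩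
  have h1 : failCount G W k = failCount (G.induce (W : Set V)) univ k := by
    rw [failCount_induce]
    simp
  have himage : univ.map e.toEmbedding = W.image f := by
    ext x
    simp [e]
  have h2 := (pathExtremal_iff _).1 (hH (W.image f : Finset X)) k
  rw [failCount_induce, Nat.card_coe_set_eq, Set.ncard_coe_finset, card_image_of_injOn hf] at h2
  rw [h1, ← failCount_map e, himage]
  simpa using h2

theorem mainTheorem3 (m : ℕ)
    (hbase : ∀ n ≤ m, ∀ H : SimpleGraph (Fin n), SplitPrime H →
      ∀ S : Set (Fin n), PathExtremal (H.induce S))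
    {V : Type*} [Finite V] (G : SimpleGraph V) (hG : UniquePrimeBagLE G m) :
    PathExtremal G := by
  classical
  obtain ⟨-, N, hN, T, ⟨hred, hrep⟩, r, hr, hcard, huniq⟩ := hG
  have := Fintype.ofFinite V
  obtain ⟨n, ⟨g⟩⟩ := Finite.exists_equiv_fin (T.BagVertex r)
  have hn : n ≤ m := by
    rw [ENat.card_congr g] at hcard
    simpa using hcard
  -- The prime label is copied onto `Fin n`, where the hypothesis is stated.
  let e := SimpleGraph.Iso.comap g.symm (T.label r)
  have hpe := hbase n hn _ (hr.of_iso e.symm)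
  rw [pathExtremal_iff, Nat.card_eq_fintype_card, ← Finset.card_univ]
  refine pathFail_le_failCount G (fun W => ?_) univ
  refine (T.exists_embedding_or_twins_or_pendant hrep r (fun c hc => ?_) W).imp_left ?_
  · rcases hred.1 c with h | h
    · exact h.2
    · exact absurd (huniq c h) hc
  · rintro ⟨f, hf, hadj⟩ k
    refine pathFail_le_failCount_of_embedding hpe W (g ∘ f) (g.injective.comp_injOn hf)
      (fun x hx y hy => ?_) k
    rw [hadj x hx y hy]
    simp
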